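/- Let $\mathcal X=\{x_1,x_2,\dots\}$ be an infinite set of string variables and fix an infinite supply of letters; an alphabet $\Sigma$ is a finite set of letters from it. A basic string term over $\Sigma$ is an element of $\mathcal X\cup\Sigma^*$, an extended string term an element of $(\mathcal X\cup\Sigma)^*$, and a length term an expression $k_0+k_1|s_1|+\dots+k_n|s_n|$ with $n\ge 0$, $k_i\in\mathbb Z$ and $s_i$ basic string terms. Formulas are Boolean combinations (with $\neg,\wedge,\vee,\Rightarrow,\Leftrightarrow$) of atoms, which are membership atoms $s\in L$, with $s$ a string term and $L\subseteq\Sigma^*$ a language from a given class, and, where allowed, length atoms $\ell_1=\ell_2$ between length terms. They are evaluated in the natural way under substitutions of words of $\Sigma^*$ for the variables. The language expressed by a variable $x$ occurring in a formula $f$ is the set of all $w\in\Sigma^*$ such that some substitution $h$ with $h(x)=w$ satisfies $f$. For each alphabet $\Sigma$, the family $\mathsf{REG}$ contains the theory (set of formulas) over $\Sigma$ whose atoms are the membership atoms $s\in L$ with $s$ basic and $L$ regular. For each alphabet $\Sigma$ and each partition of $\Sigma$ into call, internal and return letters (parts may be empty), the family $\mathsf{VPL}$ contains the theory over $\Sigma$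 whose atoms are the membership atoms $s\in L$ with $s$ basic and $L$ accepted by a visibly pushdown automaton over this partitioned alphabet. (Such an automaton is a nondeterministic finite-state automaton with a stack, without $\varepsilon$-moves, that pushes one symbol on each call letter, pops one symbol on each return letter unless the stack is empty, leaves the stack unchanged on internal letters, starts with the empty stack and accepts by final state.) Adding $+\mathsf{LEN}$ to the name of a family means that length atoms are allowed as well, and adding $+\mathsf{CON}$ means that the string terms $s$ in membership atoms may be extended. For theories $T_1,T_2$ write $T_1\preceq T_2$ if every language expressed by a variable occurring in a formula of $T_1$ is also expressed by a variable occurring in a formula of $T_2$. For families write $F_1\preceq F_2$ if for every $T_1\in F_1$ there is $T_2\in F_2$ with $T_1\preceq T_2$; $F_1\sim F_2$ if $F_1\preceq F_2$ and $F_2\preceq F_1$; and $F_1\prec F_2$ if $F_1\preceq F_2$ and not $F_1\sim F_2$. **Theorem.** (1) $\mathsf{VPL}\sim\mathsf{VPL}+\mathsf{LEN}$, and $\mathsf{VPL}\prec\mathsf{VPL}+\mathsf{CON}$ and $\mathsf{VPL}+\mathsf{LEN}\prec\mathsf{VPL}+\mathsf{CON}$. (2) $\mathsf{REG}\sim\mathsf{REG}+\mathsf{LEN}\sim\mathsf{REG}+\mathsf{LEN}+\mathsf{CON}$.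 -/

import Mathlib

universe u

namespace StringTheories

/-! ### Visibly pushdown automata -/

/-- The three kinds of letters of a pushdown alphabet. A partition of an alphabet `α` into call,
internal and return letters is a function `κ : α → LetterKind`. -/
inductive LetterKind
  | call
  | internal
  | ret

/-- A (nondeterministic) visibly pushdown automaton with states `Q` and stack symbols `Γ`.
`callStep q a` holds the pairs (new state, pushed symbol); in `retStep q a t` the argument `t` is
the popped symbol, `none` standing for the empty stack. -/
structure VPA (α : Type u) (Q Γ : Type) where
  start : Set Q
  accept : Set Q
  callStep : Q → α → Set (Q × Γ)
  internalStep : Q → α → Set Q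
  retStep : Q → α → Option Γ → Set Q

namespace VPA

variable {α : Type u} {Q Γ : Type}

/-- One step between configurations (state, stack), the head of the list being the top of the
stack. The kind of the input letter determines the stack operation. -/
inductive Step (κ : α → LetterKind) (M : VPA α Q Γ) : Q × List Γ → α → Q × List Γ → Prop
  | call {q q' : Q} {γ : Γ} {st : List Γ} {a : α} (ha : κ a = LetterKind.call)
      (h : (q', γ) ∈ M.callStep q a) : Step κ M (q, st) a (q', γ :: st)
  | internal {q q' : Q} {st : List Γ} {a : α} (ha : κ a = LetterKind.internal)
      (h : q' ∈ M.internalStep q a) : Step κ M (q, st) a (q', st)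
  | pop {q q' : Q} {γ : Γ} {st : List Γ} {a : α} (ha : κ a = LetterKind.ret)
      (h : q' ∈ M.retStep q a (some γ)) : Step κ M (q, γ :: st) a (q', st)
  | popEmpty {q q' : Q} {a : α} (ha : κ a = LetterKind.ret)
      (h : q' ∈ M.retStep q a none) : Step κ M (q, []) a (q', [])

/-- There is a run from the first configuration to the second one reading the given word. -/
def Run (κ : α → LetterKind) (M : VPA α Q Γ) : Q × List Γ → List α → Q × List Γ → Prop
  | c, [], d => c = d
  | c, a :: w, d => ∃ e, Step κ M c a e ∧ Run κ M e w d

/-- The accepted language: runs start with the empty stack, and acceptance depends only on the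
state that is reached. -/
def accepts (κ : α → LetterKind) (M : VPA α Q Γ) : Language α :=
  {w | ∃ q₀ ∈ M.start, ∃ q ∈ M.accept, ∃ st : List Γ, Run κ M (q₀, []) w (q, st)}

end VPA

/-- `L` is a visibly pushdown language for the partition `κ` of the alphabet. -/
def IsVPL {α : Type u} (κ : α → LetterKind) (L : Language α) : Prop :=
  ∃ (Q Γ : Type) (_ : Finite Q) (_ : Finite Γ) (M : VPA α Q Γ), M.accepts κ = L

/-! ### Terms and formulas -/

/-- Basic string terms: a variable (variables are numbered) or a constant word. -/
inductive BasicTerm (α : Type u)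
  | var (x : ℕ)
  | word (w : List α)

/-- Extended string terms: words over variables and letters. -/
abbrev ExtTerm (α : Type u) := List (ℕ ⊕ α)

/-- The length term `k₀ + k₁|s₁| + … + kₙ|sₙ|`, with `summands = [(k₁, s₁), …, (kₙ, sₙ)]`. -/
structure LenTerm (α : Type u) where
  const : ℤ
  summands : List (ℤ × BasicTerm α)

variable {α : Type u}

/-- A basic string term as an extended string term. -/
def BasicTerm.toExt : BasicTerm α → ExtTerm α
  | .var x => [Sum.inl x]
  | .word w => w.map Sum.inr

/-- The value of a basic string term under a substitution. -/
def BasicTerm.eval (h : ℕ → List α) : BasicTerm α → List α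
  | .var x => h x
  | .word w => w

/-- The value of an extended string term under a substitution. -/
def ExtTerm.eval (h : ℕ → List α) (s : ExtTerm α) : List α :=
  s.flatMap (Sum.elim h (fun a => [a]))

/-- The value of a length term under a substitution. -/
def LenTerm.eval (h : ℕ → List α) (l : LenTerm α) : ℤ :=
  l.const + (l.summands.map (fun p => p.1 * ((p.2.eval h).length : ℤ))).sum

/-- The variable `x` occurs in the length term. -/
def LenTerm.Occurs (x : ℕ) (l : LenTerm α) : Prop :=
  ∃ k : ℤ, (k, BasicTerm.var x) ∈ l.summands

/-- Quantifier-free formulas over the alphabet `α` with language membership atoms `s ∈ L` and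
length atoms `l₁ = l₂`. -/
inductive Formula (α : Type u)
  | mem (s : ExtTerm α) (L : Language α)
  | lenEq (l₁ l₂ : LenTerm α)
  | neg (f : Formula α)
  | and (f g : Formula α)
  | or (f g : Formula α)
  | imp (f g : Formula α)
  | iff (f g : Formula α)

namespace Formula

/-- The substitution `h` satisfies the formula. -/
def Sat (h : ℕ → List α) : Formula α → Prop
  | .mem s L => ExtTerm.eval h s ∈ L
  | .lenEq l₁ l₂ => l₁.eval h = l₂.eval h
  | .neg f => ¬ f.Sat h
  | .and f g => f.Sat h ∧ g.Sat h
  | .or f g => f.Sat h ∨ g.Sat h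
  | .imp f g => f.Sat h → g.Sat h
  | .iff f g => (f.Sat h ↔ g.Sat h)

/-- The variable `x` occurs in the formula. -/
def Occurs (x : ℕ) : Formula α → Prop
  | .mem s _ => Sum.inl x ∈ s
  | .lenEq l₁ l₂ => l₁.Occurs x ∨ l₂.Occurs x
  | .neg f => f.Occurs x
  | .and f g => f.Occurs x ∨ g.Occurs x
  | .or f g => f.Occurs x ∨ g.Occurs x
  | .imp f g => f.Occurs x ∨ g.Occurs x
  | .iff f g => f.Occurs x ∨ g.Occurs x

/-- The language expressed by the variable `x` in the formula. -/
def expressed (f : Formula α) (x : ℕ) : Language α :=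
  {w | ∃ h : ℕ → List α, f.Sat h ∧ h x = w}

/-- All membership atoms use languages in `C`, length atoms appear only if `len` holds, and
proper extended string terms appear only if `con` holds. -/
def Allowed (C : Set (Language α)) (len con : Prop) : Formula α → Prop
  | .mem s L => L ∈ C ∧ (con ∨ ∃ t : BasicTerm α, t.toExt = s)
  | .lenEq _ _ => len
  | .neg f => f.Allowed C len con
  | .and f g => f.Allowed C len con ∧ g.Allowed C len con
  | .or f g => f.Allowed C len con ∧ g.Allowed C len con
  | .imp f g => f.Allowed C len con ∧ g.Allowed C len con
  | .iff f g => f.Allowed C len con ∧ g.Allowed C len con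

end Formula

/-! ### Theories, families of theories, and their expressive power -/

/-- A theory: a finite alphabet, drawn from a common supply `A` of letters, and a set of formulas
over this alphabet. -/
structure StringTheory (A : Type u) where
  alphabet : Finset A
  formulas : Set (Formula alphabet)

namespace StringTheory

variable {A : Type u}

/-- A language over an alphabet drawn from `A`, as a set of words over `A`. Thus languages over
different alphabets can be compared. -/
def toPool {S : Finset A} (L : Language S) : Language A :=
  {w | ∃ v ∈ L, v.map Subtype.val = w}

/-- Every language expressed by a variable in a formula of `T₁` is expressed by a variable in a
formula of `T₂`. -/
def LE (T₁ T₂ : StringTheory A) : Prop :=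
  ∀ f ∈ T₁.formulas, ∀ x : ℕ, f.Occurs x →
    ∃ f' ∈ T₂.formulas, ∃ x' : ℕ, f'.Occurs x' ∧ toPool (f.expressed x) = toPool (f'.expressed x')

end StringTheory

/-- A family of theories. -/
abbrev Family (A : Type u) := Set (StringTheory A)

namespace Family

variable {A : Type u}

/-- `F₁ ⪯ F₂`. -/
def LE (F₁ F₂ : Family A) : Prop := ∀ T₁ ∈ F₁, ∃ T₂ ∈ F₂, T₁.LE T₂

/-- `F₁ ∼ F₂`. -/
def Equivalent (F₁ F₂ : Family A) : Prop := LE F₁ F₂ ∧ LE F₂ F₁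

/-- `F₁ ≺ F₂`. -/
def LT (F₁ F₂ : Family A) : Prop := LE F₁ F₂ ∧ ¬ Equivalent F₁ F₂

end Family

/-- The theories with regular membership atoms, one for each finite alphabet. -/
def regFamily (A : Type u) (len con : Prop) : Family A :=
  {T | ∃ S : Finset A, T = ⟨S, {f | f.Allowed {L | L.IsRegular} len con}⟩}

/-- The theories with visibly pushdown membership atoms, one for each finite alphabet with a fixed
partition into call, internal and return letters. -/
def vplFamily (A : Type u) (len con : Prop) : Family A :=
  {T | ∃ (S : Finset A) (κ : S → LetterKind),
    T = ⟨S, {f | f.Allowed {L | IsVPL κ L} len con}⟩}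

def REG (A : Type u) : Family A := regFamily A False False
def REG_LEN (A : Type u) : Family A := regFamily A True False
def REG_LEN_CON (A : Type u) : Family A := regFamily A True True
def VPL (A : Type u) : Family A := vplFamily A False False
def VPL_LEN (A : Type u) : Family A := vplFamily A True False
def VPL_CON (A : Type u) : Family A := vplFamily A False True

end StringTheories

namespace StringTheories

/-! ### Runs of visibly pushdown automata -/

namespace VPA

variable {α : Type u} {Q Γ Q' Γ' : Type} {κ : α → LetterKind}

/-! The regular languages, and the visibly pushdown languages for a fixed partition, form Boolean
algebras that contain the regular languages and whose members have semilinear length sets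
(`IsLengthRegular`). For such a class, the truth of a formula depends only on a finite type of each
variable's value and on the lengths of these values, and the lengths allowed for given types form a
semilinear set (`HasTypes.sat`). For a basic atom the type records membership in its language; for
an extended atom over a regular language it is the transition function induced by the word, so
concatenation becomes composition.

To project to one variable, note that another variable matters only through the lengths attainable
within its type. The expressed language is therefore a finite union of type classes cut down by
semilinear, hence regular, length conditions (`HasTypes.projection_mem`). It lies in the class
again, so a single membership atom expresses it. This gives all the equivalences.

For visibly pushdown languages, complementation is determinization by summaries (`detCompl`).
Semilinearity of lengths comes from a grammar generating the lengths of runs, where pumping yields a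
uniform period (`Gen.exists_pump`).

For strictness, let `a` be a call and `b` a return letter. With concatenation one theory expresses a
language containing `aⁿbᵐ` exactly for `n = m`, and another containing `bⁿaᵐ` exactly for `n = m`.
Without concatenation both would be visibly pushdown for one partition; the first forces `a` to be a
call letter, the second a return letter. -/

theorem run_append {M : VPA α Q Γ} {c d : Q × List Γ} {v w : List α} :
    Run κ M c (v ++ w) d ↔ ∃ e, Run κ M c v e ∧ Run κ M e w d := by
  induction v generalizing c with
  | nil => simp [Run]
  | cons a v ih =>
    simp only [List.cons_append, Run, ih]
    constructor
    · rintro ⟨e, h, e', h', h''⟩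
      exact ⟨e', ⟨e, h, h'⟩, h''⟩
    · rintro ⟨e', ⟨e, h, h'⟩, h''⟩
      exact ⟨e, h, e', h', h''⟩

theorem run_singleton {M : VPA α Q Γ} {c d : Q × List Γ} {a : α} :
    Run κ M c [a] d ↔ Step κ M c a d := by
  simp [Run]

theorem step_call {M : VPA α Q Γ} {q q' : Q} {st st' : List Γ} {a : α}
    (ha : κ a = LetterKind.call) :
    Step κ M (q, st) a (q', st') ↔ ∃ γ, (q', γ) ∈ M.callStep q a ∧ st' = γ :: st := by
  constructor
  · intro h
    cases h <;> simp_all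
  · rintro ⟨γ, h, rfl⟩
    exact .call ha h

theorem step_internal {M : VPA α Q Γ} {q q' : Q} {st st' : List Γ} {a : α}
    (ha : κ a = LetterKind.internal) :
    Step κ M (q, st) a (q', st') ↔ q' ∈ M.internalStep q a ∧ st' = st := by
  constructor
  · intro h
    cases h <;> simp_all
  · rintro ⟨h, rfl⟩
    exact .internal ha h

theorem step_ret_nil {M : VPA α Q Γ} {q q' : Q} {st' : List Γ} {a : α}
    (ha : κ a = LetterKind.ret) :
    Step κ M (q, []) a (q', st') ↔ q' ∈ M.retStep q a none ∧ st' = [] := by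
  constructor
  · intro h
    cases h <;> simp_all
  · rintro ⟨h, rfl⟩
    exact .popEmpty ha h

theorem step_ret_cons {M : VPA α Q Γ} {q q' : Q} {γ : Γ} {st st' : List Γ} {a : α}
    (ha : κ a = LetterKind.ret) :
    Step κ M (q, γ :: st) a (q', st') ↔ q' ∈ M.retStep q a (some γ) ∧ st' = st := by
  constructor
  · intro h
    cases h <;> simp_all
  · rintro ⟨h, rfl⟩
    exact .pop ha h

/-! ### Intersection -/

/-- The synchronous product of two visibly pushdown automata. -/
def inter (M : VPA α Q Γ) (N : VPA α Q' Γ') : VPA α (Q × Q') (Γ × Γ') where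
  start := M.start ×ˢ N.start
  accept := M.accept ×ˢ N.accept
  callStep q a := {r | (r.1.1, r.2.1) ∈ M.callStep q.1 a ∧ (r.1.2, r.2.2) ∈ N.callStep q.2 a}
  internalStep q a := M.internalStep q.1 a ×ˢ N.internalStep q.2 a
  retStep q a t := M.retStep q.1 a (t.map Prod.fst) ×ˢ N.retStep q.2 a (t.map Prod.snd)

/-- The input letter alone fixes the stack operation, so both stacks always have the same height and
can be stored as one stack of pairs. -/
theorem step_inter_iff {M : VPA α Q Γ} {N : VPA α Q' Γ'} {p : Q × Q'} {st : List (Γ × Γ')} {a : α}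
    {q : Q} {s : List Γ} {q' : Q'} {s' : List Γ'} :
    (∃ st', Step κ (M.inter N) (p, st) a ((q, q'), st') ∧ st'.map Prod.fst = s ∧
        st'.map Prod.snd = s') ↔
      Step κ M (p.1, st.map Prod.fst) a (q, s) ∧ Step κ N (p.2, st.map Prod.snd) a (q', s') := by
  cases ha : κ a with
  | call =>
    simp only [step_call ha, inter, Set.mem_ofPred_eq]
    constructor
    · rintro ⟨_, ⟨γ, ⟨h, h'⟩, rfl⟩, rfl, rfl⟩
      exact ⟨⟨_, h, rfl⟩, _, h', rfl⟩
    · rintro ⟨⟨γ, h, rfl⟩, γ', h', rfl⟩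
      exact ⟨_, ⟨(γ, γ'), ⟨h, h'⟩, rfl⟩, rfl, rfl⟩
  | internal =>
    simp only [step_internal ha, inter, Set.mem_prod]
    grind
  | ret =>
    cases st with
    | nil =>
      simp only [List.map_nil, step_ret_nil ha, inter, Set.mem_prod, Option.map_none]
      grind
    | cons γ st =>
      simp only [List.map_cons, step_ret_cons ha, inter, Set.mem_prod, Option.map_some]
      grind

theorem run_inter_iff {M : VPA α Q Γ} {N : VPA α Q' Γ'} {p : Q × Q'} {st : List (Γ × Γ')}
    {w : List α} {q : Q} {s : List Γ} {q' : Q'} {s' : List Γ'} :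
    (∃ st', Run κ (M.inter N) (p, st) w ((q, q'), st') ∧ st'.map Prod.fst = s ∧
        st'.map Prod.snd = s') ↔
      Run κ M (p.1, st.map Prod.fst) w (q, s) ∧ Run κ N (p.2, st.map Prod.snd) w (q', s') := by
  induction w generalizing p st with
  | nil =>
    simp only [Run, Prod.mk.injEq]
    constructor
    · rintro ⟨_, ⟨rfl, rfl⟩, rfl, rfl⟩
      simp
    · rintro ⟨⟨rfl, rfl⟩, rfl, rfl⟩
      exact ⟨st, ⟨rfl, rfl⟩, rfl, rfl⟩
  | cons a w ih =>
    simp only [Run]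
    constructor
    · rintro ⟨st', ⟨⟨⟨r, r'⟩, t⟩, h, h'⟩, h₁, h₂⟩
      have := step_inter_iff.1 ⟨t, h, rfl, rfl⟩
      have h' := ih.1 ⟨st', h', h₁, h₂⟩
      exact ⟨⟨_, this.1, h'.1⟩, _, this.2, h'.2⟩
    · rintro ⟨⟨⟨r, t⟩, h, h'⟩, ⟨r', t'⟩, h₁, h₂⟩
      obtain ⟨u, hu, rfl, rfl⟩ := step_inter_iff.2 ⟨h, h₁⟩
      obtain ⟨v, hv, hv'⟩ := (ih (p := (r, r'))).2 ⟨h', h₂⟩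
      exact ⟨v, ⟨_, hu, hv⟩, hv'⟩

theorem accepts_inter (M : VPA α Q Γ) (N : VPA α Q' Γ') :
    (M.inter N).accepts κ = M.accepts κ ⊓ N.accepts κ := by
  ext w
  constructor
  · rintro ⟨q₀, h₀, q, h, st, hr⟩
    have := run_inter_iff.1 ⟨st, hr, rfl, rfl⟩
    exact ⟨⟨_, h₀.1, _, h.1, _, this.1⟩, _, h₀.2, _, h.2, _, this.2⟩
  · rintro ⟨⟨q₀, h₀, q, h, st, hr⟩, q₀', h₀', q', h', st', hr'⟩
    obtain ⟨t, ht, -⟩ := (run_inter_iff (p := (q₀, q₀')) (st := [])).2 ⟨hr, hr'⟩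
    exact ⟨(q₀, q₀'), ⟨h₀, h₀'⟩, (q, q'), ⟨h, h'⟩, t, ht⟩

/-! ### Complementation -/

/-- States of the determinized automaton: the states that were reachable just after the last
pending call, and the summary of the well-matched word read since then. -/
abbrev DetState (Q : Type) := Set Q × Set (Q × Q)

/-- Stack symbols of the determinized automaton: the state at the time of the call and the
transitions of the call letter. -/
abbrev DetSymbol (Q Γ : Type) := DetState Q × (Q → Set (Q × Γ))

/-- The states reachable after a call. -/
def afterCall (d : DetSymbol Q Γ) : Set Q :=
  {q | ∃ r ∈ d.1.1, ∃ p γ, (r, p) ∈ d.1.2 ∧ (q, γ) ∈ d.2 p}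

/-- The determinization of `M` with acceptance negated. -/
def detCompl (M : VPA α Q Γ) : VPA α (DetState Q) (DetSymbol Q Γ) where
  start := {(M.start, {r | r.1 = r.2})}
  accept := {d | ¬ ∃ q ∈ d.1, ∃ p ∈ M.accept, (q, p) ∈ d.2}
  callStep d a :=
    {((afterCall (d, fun q => M.callStep q a), {r | r.1 = r.2}), (d, fun q => M.callStep q a))}
  internalStep d a := {(d.1, {r | ∃ p, (r.1, p) ∈ d.2 ∧ r.2 ∈ M.internalStep p a})}
  retStep d a t :=
    match t with
    | none => {(d.1, {r | ∃ p, (r.1, p) ∈ d.2 ∧ r.2 ∈ M.retStep p a none})}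
    | some c => {(c.1.1, {r | ∃ p p' s γ, (r.1, p) ∈ c.1.2 ∧ (p', γ) ∈ c.2 p ∧ (p', s) ∈ d.2 ∧
        r.2 ∈ M.retStep s a (some γ)})}

/-- The configurations of `M` described by a configuration of the determinized automaton. -/
def Describes (M : VPA α Q Γ) : Set (Q × Q) → List (DetSymbol Q Γ) → Q → List Γ → Prop
  | S, [], p, st => st = [] ∧ ∃ q ∈ M.start, (q, p) ∈ S
  | S, c :: stk, p, st => ∃ γ st', st = γ :: st' ∧ ∃ q q', Describes M c.1.2 stk q st' ∧
      (q', γ) ∈ c.2 q ∧ (q', p) ∈ S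

/-- The first component of a state of the determinized automaton fits the stack. -/
def Coherent (M : VPA α Q Γ) : Set Q → List (DetSymbol Q Γ) → Prop
  | R, [] => R = M.start
  | R, c :: stk => R = afterCall c ∧ Coherent M c.1.1 stk

/-- Coherence guarantees that every state in `R` is reached with some actual stack. Hence the
control state alone decides which states are reachable, as acceptance by final state requires. -/
theorem Coherent.exists_describes_iff {M : VPA α Q Γ} {R : Set Q} {S : Set (Q × Q)}
    {stk : List (DetSymbol Q Γ)} {p : Q} (h : Coherent M R stk) :
    (∃ st, Describes M S stk p st) ↔ ∃ q ∈ R, (q, p) ∈ S := by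
  induction stk generalizing R S p with
  | nil =>
    cases h
    simp [Describes]
  | cons c stk ih =>
    obtain ⟨rfl, h⟩ := h
    simp only [Describes]
    constructor
    · rintro ⟨_, γ, st, rfl, q, q', hd, hc, hS⟩
      obtain ⟨r, hr, hr'⟩ := (ih h).1 ⟨_, hd⟩
      exact ⟨q', ⟨r, hr, q, γ, hr', hc⟩, hS⟩
    · rintro ⟨q', ⟨r, hr, q, γ, hr', hc⟩, hS⟩
      obtain ⟨st, hd⟩ := (ih h).2 ⟨r, hr, hr'⟩
      exact ⟨_, γ, st, rfl, q, q', hd, hc, hS⟩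

/-- On a return, the summary from before the call is composed with the call, the inner summary and
the return. This is why a stack symbol stores the whole earlier state and the transition table of
the call. -/
theorem describes_step {M : VPA α Q Γ} {d d' : DetState Q} {stk stk' : List (DetSymbol Q Γ)}
    {a : α} (hs : Step κ M.detCompl (d, stk) a (d', stk')) (hc : Coherent M d.1 stk) :
    Coherent M d'.1 stk' ∧ ∀ p' st', Describes M d'.2 stk' p' st' ↔
      ∃ p st, Describes M d.2 stk p st ∧ Step κ M (p, st) a (p', st') := by
  cases ha : κ a with
  | call =>
    rw [step_call ha] at hs
    obtain ⟨c, h, rfl⟩ := hs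
    cases h
    refine ⟨⟨rfl, hc⟩, fun p' st' => ?_⟩
    simp only [Describes, step_call ha, Set.mem_ofPred_eq]
    grind
  | internal =>
    rw [step_internal ha] at hs
    obtain ⟨h, rfl⟩ := hs
    cases h
    refine ⟨hc, fun p' st' => ?_⟩
    cases stk' with
    | nil =>
      simp only [Describes, step_internal ha, Set.mem_ofPred_eq]
      grind
    | cons c stk =>
      simp only [Describes, step_internal ha, Set.mem_ofPred_eq]
      constructor
      · rintro ⟨γ, st, rfl, q, q', hd, h, p, hp, hp'⟩
        exact ⟨_, _, ⟨γ, st, rfl, q, q', hd, h, hp⟩, hp', rfl⟩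
      · rintro ⟨p, _, ⟨γ, st, rfl, q, q', hd, h, hp⟩, hp', rfl⟩
        exact ⟨γ, st, rfl, q, q', hd, h, p, hp, hp'⟩
  | ret =>
    cases stk with
    | nil =>
      rw [step_ret_nil ha] at hs
      obtain ⟨h, rfl⟩ := hs
      cases h
      refine ⟨hc, fun p' st' => ?_⟩
      simp only [Describes, Set.mem_ofPred_eq]
      constructor
      · rintro ⟨rfl, q, hq, p, hp, hp'⟩
        exact ⟨p, [], ⟨rfl, q, hq, hp⟩, (step_ret_nil ha).2 ⟨hp', rfl⟩⟩
      · rintro ⟨p, _, ⟨rfl, q, hq, hp⟩, h⟩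
        obtain ⟨hp', rfl⟩ := (step_ret_nil ha).1 h
        exact ⟨rfl, q, hq, p, hp, hp'⟩
    | cons c stk =>
      rw [step_ret_cons ha] at hs
      obtain ⟨h, rfl⟩ := hs
      cases h
      refine ⟨hc.2, fun p' st' => ?_⟩
      have key : (∃ p st, Describes M d.2 (c :: stk') p st ∧ Step κ M (p, st) a (p', st')) ↔
          ∃ q q' s γ, Describes M c.1.2 stk' q st' ∧ (q', γ) ∈ c.2 q ∧ (q', s) ∈ d.2 ∧
            p' ∈ M.retStep s a (some γ) := by
        constructor
        · rintro ⟨s, _, ⟨γ, st, rfl, q, q', hd, h, hp⟩, h'⟩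
          obtain ⟨h'', rfl⟩ := (step_ret_cons ha).1 h'
          exact ⟨q, q', s, γ, hd, h, hp, h''⟩
        · rintro ⟨q, q', s, γ, hd, h, hp, h'⟩
          exact ⟨s, _, ⟨γ, st', rfl, q, q', hd, h, hp⟩, (step_ret_cons ha).2 ⟨h', rfl⟩⟩
      rw [key]
      cases stk' with
      | nil =>
        simp only [Describes, Set.mem_ofPred_eq]
        grind
      | cons c' stk =>
        simp only [Describes, Set.mem_ofPred_eq]
        constructor
        · rintro ⟨γ, st, rfl, q, q', hd, h, p, p', s, γ', h₁, h₂, h₃, h₄⟩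
          exact ⟨p, p', s, γ', ⟨γ, st, rfl, q, q', hd, h, h₁⟩, h₂, h₃, h₄⟩
        · rintro ⟨p, p', s, γ', ⟨γ, st, rfl, q, q', hd, h, h₁⟩, h₂, h₃, h₄⟩
          exact ⟨γ, st, rfl, q, q', hd, h, p, p', s, γ', h₁, h₂, h₃, h₄⟩

theorem describes_run {M : VPA α Q Γ} {d : DetState Q} {stk : List (DetSymbol Q Γ)} {w : List α}
    (hr : Run κ M.detCompl ((M.start, {r | r.1 = r.2}), []) w (d, stk)) :
    Coherent M d.1 stk ∧ ∀ p st, Describes M d.2 stk p st ↔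
      ∃ q₀ ∈ M.start, Run κ M (q₀, []) w (p, st) := by
  induction w using List.reverseRecOn generalizing d stk with
  | nil =>
    simp only [Run, Prod.mk.injEq] at hr ⊢
    obtain ⟨rfl, rfl⟩ := hr
    refine ⟨rfl, fun p st => ?_⟩
    simp [Describes]
    grind
  | append_singleton w a ih =>
    obtain ⟨⟨d', stk'⟩, h, h'⟩ := run_append.1 hr
    obtain ⟨h₁, h₂⟩ := ih h
    obtain ⟨h₃, h₄⟩ := describes_step (run_singleton.1 h') h₁
    refine ⟨h₃, fun p st => ?_⟩
    simp only [h₄, h₂, run_append, run_singleton, Prod.exists]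
    grind

/-- Only totality is needed besides `describes_run`: the latter speaks about every run, so
uniqueness of runs never has to be proved. -/
theorem exists_run_detCompl (M : VPA α Q Γ) (w : List α) (c : DetState Q × List (DetSymbol Q Γ)) :
    ∃ d, Run κ M.detCompl c w d := by
  induction w generalizing c with
  | nil => exact ⟨c, rfl⟩
  | cons a w ih =>
    suffices ∃ e, Step κ M.detCompl c a e by
      obtain ⟨e, he⟩ := this
      obtain ⟨d, hd⟩ := ih e
      exact ⟨d, e, he, hd⟩
    obtain ⟨q, st⟩ := c
    cases ha : κ a with
    | call => exact ⟨_, .call ha rfl⟩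
    | internal => exact ⟨_, .internal ha rfl⟩
    | ret =>
      cases st with
      | nil => exact ⟨_, .popEmpty ha rfl⟩
      | cons c st => exact ⟨_, .pop ha rfl⟩

theorem accepts_detCompl (M : VPA α Q Γ) : M.detCompl.accepts κ = (M.accepts κ)ᶜ := by
  ext w
  constructor
  · rintro ⟨_, rfl, d, hd, stk, hr⟩ ⟨q₀, h₀, q, hq, st, hr'⟩
    obtain ⟨h₁, h₂⟩ := describes_run hr
    obtain ⟨r, hr, hr'⟩ := h₁.exists_describes_iff.1 ⟨st, (h₂ q st).2 ⟨q₀, h₀, hr'⟩⟩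
    exact hd ⟨r, hr, q, hq, hr'⟩
  · intro hw
    obtain ⟨⟨d, stk⟩, hr⟩ := exists_run_detCompl (κ := κ) M w ((M.start, {r | r.1 = r.2}), [])
    refine ⟨_, rfl, d, ?_, stk, hr⟩
    rintro ⟨q, hq, p, hp, hqp⟩
    obtain ⟨h₁, h₂⟩ := describes_run hr
    obtain ⟨st, hst⟩ := h₁.exists_describes_iff.2 ⟨q, hq, hqp⟩
    obtain ⟨q₀, h₀, hr'⟩ := (h₂ p st).1 hst
    exact hw ⟨q₀, h₀, p, hp, st, hr'⟩

/-! ### Finite automata -/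

/-- A deterministic finite automaton as a visibly pushdown automaton. -/
def ofDFA (M : DFA α Q) : VPA α Q Unit where
  start := {M.start}
  accept := M.accept
  callStep q a := {(M.step q a, ())}
  internalStep q a := {M.step q a}
  retStep q a _ := {M.step q a}

theorem step_ofDFA {M : DFA α Q} {q : Q} {st : List Unit} {a : α} {q' : Q} :
    (∃ st', Step κ (ofDFA M) (q, st) a (q', st')) ↔ q' = M.step q a := by
  cases ha : κ a with
  | call => simp [step_call ha, ofDFA]
  | internal => simp [step_internal ha, ofDFA]
  | ret =>
    cases st with
    | nil => simp [step_ret_nil ha, ofDFA]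
    | cons => simp [step_ret_cons ha, ofDFA]

theorem run_ofDFA {M : DFA α Q} {q : Q} {st : List Unit} {w : List α} {q' : Q} :
    (∃ st', Run κ (ofDFA M) (q, st) w (q', st')) ↔ q' = M.evalFrom q w := by
  induction w generalizing q st with
  | nil => simp [Run, eq_comm]
  | cons a w ih =>
    simp only [Run, DFA.evalFrom_cons]
    constructor
    · rintro ⟨st', ⟨r, t⟩, h, h'⟩
      obtain rfl := step_ofDFA.1 ⟨t, h⟩
      exact ih.1 ⟨st', h'⟩
    · intro h
      obtain ⟨t, ht⟩ := (step_ofDFA (κ := κ) (st := st)).2 (rfl : M.step q a = M.step q a)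
      obtain ⟨st', h'⟩ := (ih (st := t)).2 h
      exact ⟨st', _, ht, h'⟩

theorem accepts_ofDFA (M : DFA α Q) : (ofDFA M).accepts κ = M.accepts := by
  ext w
  rw [DFA.mem_accepts]
  constructor
  · rintro ⟨_, rfl, q, hq, st, hr⟩
    rwa [run_ofDFA.1 ⟨st, hr⟩] at hq
  · intro h
    obtain ⟨st, hst⟩ := (run_ofDFA (κ := κ) (M := M) (q := M.start) (st := []) (w := w)).2 rfl
    exact ⟨_, rfl, _, h, st, hst⟩

end VPA

/-! ### Closure properties of visibly pushdown languages -/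

variable {α : Type u} {κ : α → LetterKind} {L L' : Language α}

theorem IsVPL.inf (h : IsVPL κ L) (h' : IsVPL κ L') : IsVPL κ (L ⊓ L') := by
  obtain ⟨Q, Γ, _, _, M, rfl⟩ := h
  obtain ⟨Q', Γ', _, _, N, rfl⟩ := h'
  exact ⟨_, _, inferInstance, inferInstance, M.inter N, M.accepts_inter N⟩

theorem IsVPL.compl (h : IsVPL κ L) : IsVPL κ Lᶜ := by
  obtain ⟨Q, Γ, _, _, M, rfl⟩ := h
  exact ⟨_, _, inferInstance, inferInstance, M.detCompl, M.accepts_detCompl⟩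

theorem IsVPL.of_isRegular (κ : α → LetterKind) (h : L.IsRegular) : IsVPL κ L := by
  obtain ⟨Q, _, M, rfl⟩ := h
  exact ⟨_, _, inferInstance, inferInstance, VPA.ofDFA M, VPA.accepts_ofDFA M⟩

end StringTheories

namespace StringTheories

/-! ### Lengths of words generated by a grammar -/

/-- The lengths of the words derived from a nonterminal in a grammar in which every nonterminal in
`base` derives the empty word, `one A B` is a rule `A → B a` with a letter `a`, and `two c A B C` is
a rule `A → B a C` (`c = 0`) or `A → B a C a` (`c = 1`). -/
inductive Gen {V : Type} (base : Set V) (one : V → V → Prop) (two : ℕ → V → V → V → Prop) :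
    V → ℕ → Prop
  | base {A : V} (h : A ∈ base) : Gen base one two A 0
  | one {A B : V} {n : ℕ} (h : one A B) (hB : Gen base one two B n) : Gen base one two A (n + 1)
  | two {A B C : V} {m n c : ℕ} (h : two c A B C) (hc : c ≤ 1) (hB : Gen base one two B m)
      (hC : Gen base one two C n) : Gen base one two A (m + n + 1 + c)

namespace Gen

variable {V : Type} {base : Set V} {one : V → V → Prop} {two : ℕ → V → V → V → Prop}

/-- A derivation of length `m` from `B` occurs in one of length `n` from `A`. -/
def Above (base : Set V) (one : V → V → Prop) (two : ℕ → V → V → V → Prop) (A : V) (n : ℕ) (B : V)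
    (m : ℕ) : Prop :=
  m ≤ n ∧ ∀ k, Gen base one two B k → Gen base one two A (k + (n - m))

theorem Above.refl (A : V) (n : ℕ) : Above base one two A n A n :=
  ⟨le_rfl, fun k hk => by simpa using hk⟩

theorem Above.trans {A B C : V} {l m n : ℕ} (h : Above base one two A n B m)
    (h' : Above base one two B m C l) : Above base one two A n C l := by
  refine ⟨h'.1.trans h.1, fun k hk => ?_⟩
  have := h.2 _ (h'.2 k hk)
  have h₁ := h.1
  have h₂ := h'.1
  rwa [show k + (m - l) + (n - m) = k + (n - l) by omega] at this

/-- Passing to the longer of the two subderivations at most halves the length, up to the two extra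
letters. -/
theorem exists_above {A : V} {n : ℕ} (h : Gen base one two A n) (hn : 0 < n) :
    ∃ B m, Gen base one two B m ∧ m < n ∧ n ≤ 2 * m + 2 ∧ Above base one two A n B m := by
  cases h with
  | base h => omega
  | @one _ B n h hB =>
    refine ⟨B, n, hB, by omega, by omega, by omega, fun k hk => ?_⟩
    rw [show k + (n + 1 - n) = k + 1 by omega]
    exact .one h hk
  | @two _ B C m n c h hc hB hC =>
    rcases le_total m n with hmn | hmn
    · refine ⟨C, n, hC, by omega, by omega, by omega, fun k hk => ?_⟩
      rw [show k + (m + n + 1 + c - n) = m + k + 1 + c by omega]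
      exact .two h hc hB hk
    · refine ⟨B, m, hB, by omega, by omega, by omega, fun k hk => ?_⟩
      rw [show k + (m + n + 1 + c - m) = k + n + 1 + c by omega]
      exact .two h hc hk hC

/-- A length below which no branch of `N` steps can start. -/
def branchBound : ℕ → ℕ
  | 0 => 0
  | N + 1 => 2 * branchBound N + 3

theorem exists_branch (N : ℕ) {A : V} {n : ℕ} (h : Gen base one two A n) (hn : branchBound N ≤ n) :
    ∃ (B : ℕ → V) (m : ℕ → ℕ), B 0 = A ∧ m 0 = n ∧ (∀ i ≤ N, Gen base one two (B i) (m i)) ∧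
      ∀ i j, i < j → j ≤ N → m j < m i ∧ Above base one two (B i) (m i) (B j) (m j) := by
  induction N generalizing A n with
  | zero => exact ⟨fun _ => A, fun _ => n, rfl, rfl, fun _ _ => h, fun i j _ _ => by omega⟩
  | succ N ih =>
    rw [branchBound] at hn
    obtain ⟨B', m', h', hlt, hle, hab⟩ := exists_above h (by omega)
    obtain ⟨B, m, rfl, rfl, hg, hm⟩ := ih h' (by omega)
    refine ⟨fun i => i.casesOn A B, fun i => i.casesOn n m, rfl, rfl, ?_, ?_⟩
    · rintro (_ | i) hi
      · exact h
      · exact hg i (by omega)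
    · rintro (_ | i) (_ | j) hij hj
      · omega
      · rcases Nat.eq_zero_or_pos j with rfl | hj'
        · exact ⟨hlt, hab⟩
        · have := hm 0 j hj' (by omega)
          exact ⟨this.1.trans hlt, hab.trans this.2⟩
      · omega
      · exact hm i j (by omega) (by omega)

/-- A long branch repeats a nonterminal, and the part between the repetitions can be iterated. The
bound on `t` does not depend on the derivation, which later gives a common period. -/
theorem exists_pump [Finite V] : ∃ K, ∀ {A : V} {n : ℕ}, Gen base one two A n → K ≤ n →
    ∃ t, 0 < t ∧ t ≤ 2 * K + 2 ∧ ∀ k, Gen base one two A (n + k * t) := by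
  refine ⟨branchBound (Nat.card V), fun {A n} h hn => ?_⟩
  induction n using Nat.strong_induction_on generalizing A with
  | _ n ih =>
    -- Below this threshold the pumped length is bounded by `n` itself. Above it, the subderivation
    -- from `exists_above` still has length at least the branch bound, so induction applies.
    by_cases hK : n ≤ 2 * branchBound (Nat.card V) + 2
    · obtain ⟨B, m, rfl, rfl, hg, hm⟩ := exists_branch (Nat.card V) h hn
      have : Fintype V := Fintype.ofFinite V
      obtain ⟨i, j, hij, hB⟩ := Fintype.exists_ne_map_eq_of_card_lt
        (fun i : Fin (Nat.card V + 1) => B i) (by simp [Nat.card_eq_fintype_card])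
      wlog hlt : i < j generalizing i j
      · exact this j i hij.symm hB.symm (lt_of_le_of_ne (not_lt.1 hlt) hij.symm)
      have hi : (i : ℕ) ≤ Nat.card V := Nat.lt_succ_iff.1 i.2
      have hj : (j : ℕ) ≤ Nat.card V := Nat.lt_succ_iff.1 j.2
      obtain ⟨hmij, hab⟩ := hm i j hlt hj
      have h0 : Above base one two (B 0) (m 0) (B i) (m i) := by
        rcases Nat.eq_zero_or_pos (i : ℕ) with h0 | h0
        · rw [h0]
          exact .refl _ _
        · exact (hm 0 i h0 hi).2
      have hi0 := h0.1
      refine ⟨m i - m j, by omega, by omega, fun k => ?_⟩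
      have key : Gen base one two (B i) (m i + k * (m i - m j)) := by
        induction k with
        | zero => simpa using hg i hi
        | succ k ihk =>
          have hB : B i = B j := hB
          rw [hB] at ihk
          have := hab.2 _ ihk
          rwa [add_assoc, ← Nat.succ_mul] at this
      have := h0.2 _ key
      rwa [show m i + k * (m i - m j) + (m 0 - m i) = m 0 + k * (m i - m j) by omega] at this
    · obtain ⟨B, m, hB, hlt, hle, hab⟩ := exists_above h (by omega)
      obtain ⟨t, ht, ht', hk⟩ := ih m hlt hB (by omega)
      refine ⟨t, ht, ht', fun k => ?_⟩
      have := hab.2 _ (hk k)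
      rwa [show m + k * t + (n - m) = n + k * t by omega] at this

end Gen

/-- A set of natural numbers that is closed under addition of `p`, above some bound, is
semilinear. -/
theorem isSemilinearSet_of_add_mem {s : Set ℕ} {K p : ℕ} (hp : 0 < p)
    (h : ∀ n ≥ K, n ∈ s → n + p ∈ s) : IsSemilinearSet s := by
  classical
  have hk : ∀ k, ∀ n ≥ K, n ∈ s → n + k * p ∈ s := by
    intro k n hn hs
    induction k with
    | zero => simpa using hs
    | succ k ih =>
      rw [Nat.succ_mul, ← add_assoc]
      exact h _ (by omega) ih
  -- If a residue class has an element of `s` beyond `K`, it lies in `s` entirely from there on;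
  -- otherwise it misses `s` beyond `K`. Either way membership eventually descends by `p`.
  have hb : ∀ r : Fin p, ∃ b, ∀ n ≥ b, n % p = r → n + p ∈ s → n ∈ s := by
    intro r
    by_cases hr : ∃ n ≥ K, n % p = r ∧ n ∈ s
    · obtain ⟨m, hm, hmr, hms⟩ := hr
      refine ⟨m, fun n hn hnr _ => ?_⟩
      have hd : p ∣ n - m := (Nat.modEq_iff_dvd' hn).1 (hmr.trans hnr.symm)
      obtain ⟨k, hk'⟩ := hd
      have := hk k m hm hms
      rwa [mul_comm, ← hk', Nat.add_sub_cancel' hn] at this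
    · refine ⟨K, fun n hn hnr hs => (hr ⟨n + p, by omega, by simpa using hnr, hs⟩).elim⟩
  choose b hb using hb
  refine Nat.isSemilinearSet_iff_ultimately_periodic.2
    ⟨K + ∑ r, b r, p, hp, fun n hn => ⟨h n (by omega), fun hs => ?_⟩⟩
  refine hb ⟨n % p, Nat.mod_lt _ hp⟩ n ?_ rfl hs
  have : b ⟨n % p, Nat.mod_lt _ hp⟩ ≤ ∑ r, b r :=
    Finset.single_le_sum (fun _ _ => Nat.zero_le _) (Finset.mem_univ _)
  omega

/-- The factorial of `2 * K + 2` is a multiple of every possible pumping length, so it is a common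
period. -/
theorem Gen.isSemilinearSet {V : Type} [Finite V] (base : Set V) (one : V → V → Prop)
    (two : ℕ → V → V → V → Prop) (A : V) : IsSemilinearSet {n | Gen base one two A n} := by
  obtain ⟨K, hK⟩ := Gen.exists_pump (base := base) (one := one) (two := two)
  refine isSemilinearSet_of_add_mem (K := K) (Nat.factorial_pos (2 * K + 2)) fun n hn hs => ?_
  obtain ⟨t, ht, ht', hk⟩ := hK hs hn
  obtain ⟨k, hk'⟩ := Nat.dvd_factorial ht ht'
  have := hk k
  rwa [mul_comm, ← hk'] at this

/-! ### A grammar for the lengths of runs -/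

namespace VPA

variable {α : Type u} {Q Γ : Type} {κ : α → LetterKind}

/-- Kinds of runs: well-matched ones; those from the empty stack to the empty stack; those from the
empty stack to a nonempty one. -/
inductive RunKind
  | matched
  | bottom
  | pending

instance : Finite RunKind :=
  Finite.of_injective (β := Fin 3)
    (fun k => match k with | .matched => 0 | .bottom => 1 | .pending => 2)
    (by rintro (_ | _ | _) (_ | _ | _) <;> simp)

/-- The nonterminals for the empty run. -/
def lenBase (Q : Type) : Set (RunKind × Q × Q) := {A | A.1 ≠ .pending ∧ A.2.1 = A.2.2}

/-- Runs that end with an internal letter or with a return letter on the empty stack. -/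
def lenOne (κ : α → LetterKind) (M : VPA α Q Γ) (A B : RunKind × Q × Q) : Prop :=
  A.2.1 = B.2.1 ∧ ∃ a, A.1 = B.1 ∧ κ a = .internal ∧ A.2.2 ∈ M.internalStep B.2.2 a ∨
    A.1 = .bottom ∧ B.1 = .bottom ∧ κ a = .ret ∧ A.2.2 ∈ M.retStep B.2.2 a none

/-- Runs that contain a pending call, followed by a matched run (`c = 0`), and runs that end with
the return letter (`c = 1`) of a call. -/
def lenTwo (κ : α → LetterKind) (M : VPA α Q Γ) (c : ℕ) (A B C : RunKind × Q × Q) : Prop :=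
  A.2.1 = B.2.1 ∧ C.1 = .matched ∧ ∃ a γ, κ a = .call ∧ (C.2.1, γ) ∈ M.callStep B.2.2 a ∧
    (c = 0 ∧ A.1 = .pending ∧ B.1 ≠ .matched ∧ A.2.2 = C.2.2 ∨
      c = 1 ∧ A.1 = B.1 ∧ ∃ b, κ b = .ret ∧ A.2.2 ∈ M.retStep C.2.2 b (some γ))

/-- The possible lengths of the runs of a given kind between two states. -/
abbrev LenGen (κ : α → LetterKind) (M : VPA α Q Γ) (k : RunKind) (p q : Q) (n : ℕ) : Prop :=
  Gen (lenBase Q) (lenOne κ M) (lenTwo κ M) (k, p, q) n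

/-- The word `w` has a run of the given kind. -/
def KindRun (κ : α → LetterKind) (M : VPA α Q Γ) (p q : Q) (w : List α) : RunKind → Prop
  | .matched => ∀ st, Run κ M (p, st) w (q, st)
  | .bottom => Run κ M (p, []) w (q, [])
  | .pending => ∃ st, Run κ M (p, []) w (q, st)

/-- Each rule is realized by concatenating runs. Matched runs must work over every stack because
they are inserted above pushed symbols. -/
theorem exists_kindRun {M : VPA α Q Γ} {A : RunKind × Q × Q} {n : ℕ}
    (h : Gen (lenBase Q) (lenOne κ M) (lenTwo κ M) A n) :
    ∃ w : List α, w.length = n ∧ KindRun κ M A.2.1 A.2.2 w A.1 := by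
  induction h with
  | @base A h =>
    obtain ⟨k, p, q⟩ := A
    obtain ⟨hk, rfl : p = q⟩ := h
    refine ⟨[], rfl, ?_⟩
    cases k <;> simp_all [KindRun, Run]
  | @one A B n h _ ih =>
    obtain ⟨k, p, q⟩ := A
    obtain ⟨k', p', q'⟩ := B
    obtain ⟨w, hw, hr⟩ := ih
    obtain ⟨rfl : p = p', a, ⟨rfl : k = k', ha, hq⟩ | ⟨rfl : k = _, rfl : k' = _, ha, hq⟩⟩ := h
    · refine ⟨w ++ [a], by simp [hw], ?_⟩
      have hs : ∀ st, Step κ M (q', st) a (q, st) := fun st => .internal ha hq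
      cases k with
      | matched => exact fun st => run_append.2 ⟨_, hr st, run_singleton.2 (hs st)⟩
      | bottom => exact run_append.2 ⟨_, hr, run_singleton.2 (hs [])⟩
      | pending =>
        obtain ⟨st, hr⟩ := hr
        exact ⟨st, run_append.2 ⟨_, hr, run_singleton.2 (hs st)⟩⟩
    · exact ⟨w ++ [a], by simp [hw], run_append.2 ⟨_, hr, run_singleton.2 (.popEmpty ha hq)⟩⟩
  | @two A B C m n c h _ _ _ ih ih' =>
    obtain ⟨k, p, q⟩ := A
    obtain ⟨k', p', q'⟩ := B
    obtain ⟨k'', p'', q''⟩ := C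
    obtain ⟨w, hw, hr⟩ := ih
    obtain ⟨w', hw', hr'⟩ := ih'
    obtain ⟨rfl : p = p', rfl : k'' = _, a, γ, ha, hγ, ⟨rfl, rfl : k = _, hk, rfl : q = q''⟩ |
      ⟨rfl, rfl : k = k', b, hb, hq⟩⟩ := h
    · refine ⟨w ++ a :: w', by simp [hw, hw']; omega, ?_⟩
      have hs : ∀ st, Run κ M (q', st) (a :: w') (q, γ :: st) :=
        fun st => ⟨_, .call ha hγ, hr' _⟩
      cases k' with
      | matched => exact (hk rfl).elim
      | bottom => exact ⟨_, run_append.2 ⟨_, hr, hs []⟩⟩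
      | pending =>
        obtain ⟨st, hr⟩ := hr
        exact ⟨_, run_append.2 ⟨_, hr, hs st⟩⟩
    · refine ⟨w ++ a :: (w' ++ [b]), by simp [hw, hw']; omega, ?_⟩
      have hs : ∀ st, Run κ M (q', st) (a :: (w' ++ [b])) (q, st) :=
        fun st => ⟨_, .call ha hγ, run_append.2 ⟨_, hr' _, run_singleton.2 (.pop hb hq)⟩⟩
      cases k with
      | matched => exact fun st => run_append.2 ⟨_, hr st, hs st⟩
      | bottom => exact run_append.2 ⟨_, hr, hs []⟩
      | pending =>
        obtain ⟨st, hr⟩ := hr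
        exact ⟨st, run_append.2 ⟨_, hr, hs st⟩⟩

/-- The kind of the runs from the empty stack to the given one. -/
def kindOf (st : List Γ) : RunKind :=
  match st with
  | [] => .bottom
  | _ :: _ => .pending

/-- Lengths of runs from the empty stack to `st`, split at the pending calls. -/
def StackGen (κ : α → LetterKind) (M : VPA α Q Γ) (p : Q) : Q → List Γ → ℕ → Prop
  | q, [], n => LenGen κ M .bottom p q n
  | q, γ :: st, n => ∃ r r' a m l, StackGen κ M p r st m ∧ κ a = .call ∧
      (r', γ) ∈ M.callStep r a ∧ LenGen κ M .matched r' q l ∧ n = m + l + 1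

/-- Each pending call contributes one `lenTwo` rule with `c = 0`; folding over the stack forgets it.
-/
theorem StackGen.lenGen {M : VPA α Q Γ} {p q : Q} {st : List Γ} {n : ℕ}
    (h : StackGen κ M p q st n) : LenGen κ M (kindOf st) p q n := by
  induction st generalizing q n with
  | nil => exact h
  | cons γ st ih =>
    obtain ⟨r, r', a, m, l, h₁, ha, hγ, h₂, rfl⟩ := h
    refine Gen.two (c := 0) (B := (_, p, r)) (C := (_, r', q)) ⟨rfl, rfl, a, γ, ha, hγ, .inl ⟨rfl, rfl, ?_, rfl⟩⟩ (by simp) (ih h₁) h₂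
    cases st <;> simp [kindOf]

/-- A new letter affects only the top of the decomposition: a call opens an empty matched segment,
an internal letter extends the last segment, and a matching return merges it into the one below. -/
theorem StackGen.step {M : VPA α Q Γ} {p q q' : Q} {st st' : List Γ} {a : α} {n : ℕ}
    (h : StackGen κ M p q st n) (hs : Step κ M (q, st) a (q', st')) :
    StackGen κ M p q' st' (n + 1) := by
  cases hs with
  | call ha hγ => exact ⟨q, q', a, n, 0, h, ha, hγ, .base (by simp [lenBase]), rfl⟩
  | internal ha hq =>
    cases st with
    | nil => exact .one (B := (_, p, q)) ⟨rfl, a, .inl ⟨rfl, ha, hq⟩⟩ h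
    | cons γ st =>
      obtain ⟨r, r', b, m, l, h₁, hb, hγ, h₂, rfl⟩ := h
      exact ⟨r, r', b, m, l + 1, h₁, hb, hγ,
        .one (B := (_, r', q)) ⟨rfl, a, .inl ⟨rfl, ha, hq⟩⟩ h₂, by omega⟩
  | @pop _ _ γ _ _ ha hq =>
    obtain ⟨r, r', b, m, l, h₁, hb, hγ, h₂, rfl⟩ := h
    have key : ∀ k s m', LenGen κ M k s r m' → LenGen κ M k s q' (m' + l + 1 + 1) :=
      fun k s m' h => .two (c := 1) (B := (_, s, r)) (C := (_, r', q))
        ⟨rfl, rfl, b, γ, hb, hγ, .inr ⟨rfl, rfl, a, ha, hq⟩⟩ le_rfl h h₂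
    cases st' with
    | nil => exact key _ _ _ h₁
    | cons γ st =>
      obtain ⟨s, s', c, m', l', h₃, hc, hγ', h₄, rfl⟩ := h₁
      exact ⟨s, s', c, m', _, h₃, hc, hγ', key _ _ _ h₄, by omega⟩
  | popEmpty ha hq => exact .one (B := (_, p, q)) ⟨rfl, a, .inr ⟨rfl, rfl, ha, hq⟩⟩ h

theorem stackGen_of_run {M : VPA α Q Γ} {p q : Q} {w : List α} {st : List Γ}
    (h : Run κ M (p, []) w (q, st)) : StackGen κ M p q st w.length := by
  induction w using List.reverseRecOn generalizing q st with
  | nil =>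
    simp only [Run, Prod.mk.injEq] at h
    obtain ⟨rfl, rfl⟩ := h
    exact .base (by simp [lenBase])
  | append_singleton w a ih =>
    obtain ⟨⟨r, t⟩, h₁, h₂⟩ := run_append.1 h
    simpa using (ih h₁).step (run_singleton.1 h₂)

end VPA

/-- The lengths of the words of a visibly pushdown language form a semilinear set. -/
theorem IsVPL.isSemilinearSet_length {α : Type u} {κ : α → LetterKind} {L : Language α}
    (h : IsVPL κ L) : IsSemilinearSet {n | ∃ w ∈ L, w.length = n} := by
  classical
  obtain ⟨Q, Γ, _, _, M, rfl⟩ := h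
  have key : {n | ∃ w ∈ M.accepts κ, w.length = n} = ⋃ (k : VPA.RunKind) (p : Q) (q : Q),
      if k ≠ .matched ∧ p ∈ M.start ∧ q ∈ M.accept then {n | VPA.LenGen κ M k p q n} else ∅ := by
    ext n
    simp only [Set.mem_ofPred_eq, Set.mem_iUnion]
    constructor
    · rintro ⟨w, ⟨p, hp, q, hq, st, hr⟩, rfl⟩
      refine ⟨VPA.kindOf st, p, q, ?_⟩
      rw [if_pos ⟨by cases st <;> simp [VPA.kindOf], hp, hq⟩]
      exact (VPA.stackGen_of_run hr).lenGen
    · rintro ⟨k, p, q, h⟩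
      split_ifs at h with hk
      · obtain ⟨hk, hp, hq⟩ := hk
        obtain ⟨w, hw, hr⟩ := VPA.exists_kindRun h
        refine ⟨w, ⟨p, hp, q, hq, ?_⟩, hw⟩
        cases k with
        | matched => exact (hk rfl).elim
        | bottom => exact ⟨[], hr⟩
        | pending => exact hr
      · exact h.elim
  rw [key]
  refine .iUnion fun k => .iUnion fun p => .iUnion fun q => ?_
  split_ifs
  · exact Gen.isSemilinearSet _ _ _ _
  · exact .empty

end StringTheories

namespace StringTheories

variable {α : Type u}

/-! ### Languages given by the lengths of their words -/

/-- The words whose length lies in a semilinear set form a regular language. -/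
theorem isRegular_length_mem {X : Set ℕ} (hX : IsSemilinearSet X) :
    Language.IsRegular ({w | w.length ∈ X} : Language α) := by
  obtain ⟨k, p, hp, h⟩ := Nat.isSemilinearSet_iff_ultimately_periodic.1 hX
  -- Subtracting periods leaves the admissible continuations unchanged, so there are at most `k + p`
  -- left quotients and Myhill–Nerode applies.
  have key : ∀ n, ∃ i < k + p, ∀ j, n + j ∈ X ↔ i + j ∈ X := by
    intro n
    induction n using Nat.strong_induction_on with
    | _ n ih =>
      by_cases hn : n < k + p
      · exact ⟨n, hn, fun _ => Iff.rfl⟩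
      · obtain ⟨i, hi, hij⟩ := ih (n - p) (by omega)
        refine ⟨i, hi, fun j => ?_⟩
        rw [← hij j, h (n - p + j) (by omega), show n - p + j + p = n + j by omega]
  refine Language.isRegular_iff_finite_range_leftQuotient.2 (((Finset.range (k + p)).finite_toSet.image
    fun i => ({y | i + y.length ∈ X} : Language α)).subset ?_)
  rintro _ ⟨x, rfl⟩
  obtain ⟨i, hi, hij⟩ := key x.length
  refine ⟨i, by simpa using hi, ?_⟩
  ext y
  change i + y.length ∈ X ↔ (x ++ y).length ∈ X
  rw [List.length_append, hij]

theorem mem_of_forall_iff {C : Set (Language α)} {L L' : Language α} (h : L ∈ C)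
    (hL : ∀ w, w ∈ L' ↔ w ∈ L) : L' ∈ C := by
  rwa [show L' = L from Set.ext hL]

/-- A Boolean algebra of languages that contains the regular ones, and whose members have semilinear
length sets. -/
structure IsLengthRegular (C : Set (Language α)) : Prop where
  compl {L : Language α} : L ∈ C → Lᶜ ∈ C
  inf {L L' : Language α} : L ∈ C → L' ∈ C → L ⊓ L' ∈ C
  of_isRegular {L : Language α} : L.IsRegular → L ∈ C
  length {L : Language α} : L ∈ C → IsSemilinearSet {n | ∃ w ∈ L, w.length = n}

theorem isLengthRegular_isVPL (κ : α → LetterKind) : IsLengthRegular {L | IsVPL κ L} where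
  compl h := h.compl
  inf h h' := h.inf h'
  of_isRegular h := .of_isRegular κ h
  length h := h.isSemilinearSet_length

/-- Semilinearity of lengths is inherited from visibly pushdown languages by declaring all letters
internal. -/
theorem isLengthRegular_isRegular : IsLengthRegular {L : Language α | L.IsRegular} where
  compl h := h.compl
  inf h h' := h.inf h'
  of_isRegular h := h
  length h := (IsVPL.of_isRegular (fun _ => .internal) h).isSemilinearSet_length

namespace IsLengthRegular

variable {C : Set (Language α)}

theorem length_mem (hC : IsLengthRegular C) {X : Set ℕ} (hX : IsSemilinearSet X) :
    ({w | w.length ∈ X} : Language α) ∈ C :=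
  hC.of_isRegular (isRegular_length_mem hX)

theorem const_mem (hC : IsLengthRegular C) (p : Prop) : ({_w | p} : Language α) ∈ C := by
  by_cases hp : p
  · refine mem_of_forall_iff (hC.length_mem IsSemilinearSet.univ) fun w => ?_
    exact iff_of_true hp trivial
  · refine mem_of_forall_iff (hC.length_mem IsSemilinearSet.empty) fun w => ?_
    exact iff_of_false hp id

theorem exists_mem (hC : IsLengthRegular C) {ι : Type*} [Finite ι] {L : ι → Language α}
    (hL : ∀ i, L i ∈ C) : ({w | ∃ i, w ∈ L i} : Language α) ∈ C := by
  classical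
  have : Fintype ι := Fintype.ofFinite ι
  have key : ∀ s : Finset ι, ({w | ∃ i ∈ s, w ∈ L i} : Language α) ∈ C := by
    intro s
    induction s using Finset.induction_on with
    | empty =>
      refine mem_of_forall_iff (hC.const_mem False) fun w => ?_
      change (∃ i ∈ (∅ : Finset ι), w ∈ L i) ↔ False
      simp
    | insert a s _ ih =>
      refine mem_of_forall_iff (hC.compl (hC.inf (hC.compl (hL a)) (hC.compl ih))) fun w => ?_
      change (∃ i ∈ insert a s, w ∈ L i) ↔ ¬ (w ∉ L a ∧ ¬ ∃ i ∈ s, w ∈ L i)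
      simp only [Finset.mem_insert]
      grind
  refine mem_of_forall_iff (key Finset.univ) fun w => ?_
  change (∃ i, w ∈ L i) ↔ (∃ i ∈ Finset.univ, w ∈ L i)
  simp

end IsLengthRegular

/-! ### Conditions that depend on the types and the lengths of words -/

/-- The truth of the condition `P` is determined by the lengths of the values of the first `N`
variables and by their types, for a classification of words into finitely many types each of which
is a language in `C`; the lengths allowed for given types form a semilinear set. -/
def HasTypes (C : Set (Language α)) (N : ℕ) (P : (ℕ → List α) → Prop) : Prop :=
  ∃ (M : Type) (_ : Finite M) (τ : List α → M) (F : (Fin N → M) → Set (Fin N → ℕ)),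
    (∀ m, ({w | τ w = m} : Language α) ∈ C) ∧ (∀ m, IsSemilinearSet (F m)) ∧
      ∀ h, P h ↔ (fun i : Fin N => (h i).length) ∈ F (fun i => τ (h i))

namespace HasTypes

variable {C : Set (Language α)} {N : ℕ} {P P' : (ℕ → List α) → Prop}

theorem not (hP : HasTypes C N P) : HasTypes C N (fun h => ¬ P h) := by
  obtain ⟨M, _, τ, F, hτ, hF, h⟩ := hP
  exact ⟨M, inferInstance, τ, fun m => (F m)ᶜ, hτ, fun m => (hF m).compl, fun g => not_congr (h g)⟩

theorem and (hC : IsLengthRegular C) (hP : HasTypes C N P) (hP' : HasTypes C N P') :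
    HasTypes C N (fun h => P h ∧ P' h) := by
  obtain ⟨M, _, τ, F, hτ, hF, h⟩ := hP
  obtain ⟨M', _, τ', F', hτ', hF', h'⟩ := hP'
  refine ⟨M × M', inferInstance, fun w => (τ w, τ' w),
    fun m => F (fun i => (m i).1) ∩ F' (fun i => (m i).2), fun m => ?_,
    fun m => (hF _).inter (hF' _), fun g => and_congr (h g) (h' g)⟩
  refine mem_of_forall_iff (hC.inf (hτ m.1) (hτ' m.2)) fun w => ?_
  exact Prod.ext_iff

theorem or (hC : IsLengthRegular C) (hP : HasTypes C N P) (hP' : HasTypes C N P') :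
    HasTypes C N (fun h => P h ∨ P' h) := by
  simpa only [not_and_or, not_not] using (hP.not.and hC hP'.not).not

theorem imp (hC : IsLengthRegular C) (hP : HasTypes C N P) (hP' : HasTypes C N P') :
    HasTypes C N (fun h => P h → P' h) := by
  simpa only [imp_iff_not_or] using hP.not.or hC hP'

theorem iff (hC : IsLengthRegular C) (hP : HasTypes C N P) (hP' : HasTypes C N P') :
    HasTypes C N (fun h => P h ↔ P' h) := by
  simpa only [iff_iff_implies_and_implies] using (hP.imp hC hP').and hC (hP'.imp hC hP)

theorem const (hC : IsLengthRegular C) (p : Prop) : HasTypes C N (fun _ => p) := by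
  refine ⟨Unit, inferInstance, fun _ => (), fun _ => {_n | p}, fun m => hC.const_mem _, fun m => ?_,
    fun _ => Iff.rfl⟩
  by_cases hp : p <;> simp [hp]

theorem mem_basic (hC : IsLengthRegular C) {L : Language α} (hL : L ∈ C) (t : BasicTerm α)
    (ht : ∀ x, Sum.inl x ∈ t.toExt → x < N) : HasTypes C N (fun h => ExtTerm.eval h t.toExt ∈ L) := by
  cases t with
  | word w =>
    convert! const hC (w ∈ L) using 2 with h
    simp [BasicTerm.toExt, ExtTerm.eval, List.flatMap_map]
  | var x =>
    refine ⟨Prop, inferInstance, fun w => w ∈ L, fun m => {_n | m ⟨x, ht x (by simp [BasicTerm.toExt])⟩},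
      fun m => ?_, fun m => ?_, fun h => ?_⟩
    · by_cases hm : m
      · refine mem_of_forall_iff (hL) fun w => ?_
        change ((w ∈ L) = m) ↔ _
        simp [hm]
      · refine mem_of_forall_iff (hC.compl hL) fun w => ?_
        change ((w ∈ L) = m) ↔ w ∉ L
        simp [hm]
    · by_cases hm : m ⟨x, ht x (by simp [BasicTerm.toExt])⟩ <;> simp [hm]
    · simp [BasicTerm.toExt, ExtTerm.eval]

/-- The words that induce a given transition function form a regular language. -/
theorem _root_.StringTheories.isRegular_evalFrom_eq {σ : Type} [Finite σ] (M : DFA α σ)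
    (m : σ → σ) : Language.IsRegular ({w | (fun q => M.evalFrom q w) = m} : Language α) := by
  classical
  have : Fintype σ := Fintype.ofFinite σ
  let D : DFA α (σ → σ) := ⟨fun g a q => M.step (g q) a, id, {m}⟩
  have key : ∀ (w : List α) g, D.evalFrom g w = fun q => M.evalFrom (g q) w := by
    intro w
    induction w with
    | nil => exact fun _ => rfl
    | cons a w ih => exact fun g => ih _
  refine ⟨_, inferInstance, D, ?_⟩
  ext w
  rw [DFA.mem_accepts]
  change D.evalFrom id w = m ↔ _
  rw [key]
  rfl

/-- The type of a word is its transition function, and reading the term composes these functions. No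
length condition is needed. -/
theorem mem_ext_of_isRegular {L : Language α} (hL : L.IsRegular) (s : ExtTerm α)
    (hs : ∀ x, Sum.inl x ∈ s → x < N) :
    HasTypes {L : Language α | L.IsRegular} N (fun h => ExtTerm.eval h s ∈ L) := by
  obtain ⟨σ, _, M, rfl⟩ := hL
  -- The default value for variables outside the range is never used, by `hs`.
  let step (m : Fin N → σ → σ) (q : σ) (c : ℕ ⊕ α) : σ :=
    Sum.elim (fun x => if hx : x < N then m ⟨x, hx⟩ q else q) (M.step q) c
  have key : ∀ (h : ℕ → List α) (s : ExtTerm α), (∀ x, Sum.inl x ∈ s → x < N) → ∀ q,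
      M.evalFrom q (ExtTerm.eval h s) = s.foldl (step fun i q => M.evalFrom q (h i)) q := by
    intro h s
    induction s with
    | nil => exact fun _ _ => rfl
    | cons c s ih =>
      intro hs q
      simp only [ExtTerm.eval, List.flatMap_cons, List.foldl_cons, DFA.evalFrom_of_append]
      refine (ih (fun x hx => hs x (List.mem_cons_of_mem _ hx)) _).trans ?_
      congr 1
      cases c with
      | inl x => simp [step, hs x List.mem_cons_self]
      | inr a => simp [step]
  refine ⟨σ → σ, inferInstance, fun w q => M.evalFrom q w,
    fun m => {_n | s.foldl (step m) M.start ∈ M.accept}, isRegular_evalFrom_eq M, fun m => ?_,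
    fun h => ?_⟩
  · by_cases hm : s.foldl (step m) M.start ∈ M.accept <;> simp [hm]
  · change ExtTerm.eval h s ∈ M.accepts ↔
      s.foldl (step fun i q => M.evalFrom q (h i)) M.start ∈ M.accept
    rw [DFA.mem_accepts, DFA.eval, key h s hs]

theorem _root_.StringTheories.LenTerm.exists_addMonoidHom (l : LenTerm α)
    (hl : ∀ x, l.Occurs x → x < N) :
    ∃ φ : (Fin N → ℕ) →+ ℤ, ∃ c : ℤ, ∀ h, l.eval h = c + φ (fun i => (h i).length) := by
  obtain ⟨k₀, s⟩ := l
  simp only [LenTerm.Occurs] at hl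
  simp only [LenTerm.eval]
  induction s with
  | nil => exact ⟨0, k₀, fun _ => by simp⟩
  | cons p s ih =>
    obtain ⟨φ, c, hφ⟩ := ih fun x ⟨k, hk⟩ => hl x ⟨k, List.mem_cons_of_mem _ hk⟩
    obtain ⟨k, x | w⟩ := p
    · have hx : x < N := hl x ⟨k, List.mem_cons_self⟩
      refine ⟨φ + k • (Nat.castAddMonoidHom ℤ).comp (Pi.evalAddMonoidHom _ ⟨x, hx⟩), c,
        fun h => ?_⟩
      have := hφ h
      simp only [BasicTerm.eval] at this
      simp only [List.map_cons, List.sum_cons, BasicTerm.eval, AddMonoidHom.add_apply,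
        AddMonoidHom.smul_apply, AddMonoidHom.comp_apply, Pi.evalAddMonoidHom_apply,
        Nat.coe_castAddMonoidHom, smul_eq_mul]
      linarith
    · refine ⟨φ, c + k * w.length, fun h => ?_⟩
      have := hφ h
      simp only [BasicTerm.eval] at this
      simp only [List.map_cons, List.sum_cons, BasicTerm.eval]
      linarith

theorem lenEq (hC : IsLengthRegular C) (l₁ l₂ : LenTerm α) (h₁ : ∀ x, l₁.Occurs x → x < N)
    (h₂ : ∀ x, l₂.Occurs x → x < N) : HasTypes C N (fun h => l₁.eval h = l₂.eval h) := by
  obtain ⟨φ, c, hφ⟩ := l₁.exists_addMonoidHom h₁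
  obtain ⟨ψ, d, hψ⟩ := l₂.exists_addMonoidHom h₂
  refine ⟨Unit, inferInstance, fun _ => (), fun _ => {n | c + φ n = d + ψ n},
    fun m => hC.const_mem _, fun m => isSemilinearSet_setOfPred_eq c d φ ψ, fun h => ?_⟩
  change l₁.eval h = l₂.eval h ↔ _
  rw [hφ, hψ]
  rfl

/-- Formulas have types if their membership atoms do. -/
theorem sat (hC : IsLengthRegular C) {len con : Prop}
    (hmem : ∀ (s : ExtTerm α) (L : Language α), L ∈ C → (con ∨ ∃ t : BasicTerm α, t.toExt = s) →
      (∀ x, Sum.inl x ∈ s → x < N) → HasTypes C N (fun h => ExtTerm.eval h s ∈ L))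
    (f : Formula α) (hf : f.Allowed C len con) (hN : ∀ x, f.Occurs x → x < N) :
    HasTypes C N (fun h => f.Sat h) := by
  induction f with
  | mem s L => exact hmem s L hf.1 hf.2 hN
  | lenEq l₁ l₂ => exact lenEq hC l₁ l₂ (fun x h => hN x (.inl h)) (fun x h => hN x (.inr h))
  | neg f ih => exact (ih hf hN).not
  | and f g ih ih' =>
    exact (ih hf.1 fun x h => hN x (.inl h)).and hC (ih' hf.2 fun x h => hN x (.inr h))
  | or f g ih ih' =>
    exact (ih hf.1 fun x h => hN x (.inl h)).or hC (ih' hf.2 fun x h => hN x (.inr h))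
  | imp f g ih ih' =>
    exact (ih hf.1 fun x h => hN x (.inl h)).imp hC (ih' hf.2 fun x h => hN x (.inr h))
  | iff f g ih ih' =>
    exact (ih hf.1 fun x h => hN x (.inl h)).iff hC (ih' hf.2 fun x h => hN x (.inr h))

/-- Values of the same type and length are interchangeable, so only the attainable length vectors `G
m` matter for each tuple `m` of types. -/
theorem projection_mem (hC : IsLengthRegular C) (hP : HasTypes C N P) {x : ℕ} (hx : x < N) :
    ({w | ∃ h, P h ∧ h x = w} : Language α) ∈ C := by
  obtain ⟨M, _, τ, F, hτ, hF, hP⟩ := hP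
  let G (m : Fin N → M) : Set (Fin N → ℕ) :=
    F m ∩ ⋂ y, Pi.evalAddMonoidHom (fun _ => ℕ) y ⁻¹'
      {n | ∃ w ∈ ({w | τ w = m y} : Language α), w.length = n}
  have hG : ∀ m, IsSemilinearSet (G m) := fun m =>
    (hF m).inter (.iInter fun y => (hC.length (hτ (m y))).preimage _)
  refine mem_of_forall_iff (hC.exists_mem fun m => hC.inf (hτ (m ⟨x, hx⟩))
    (hC.length_mem ((hG m).image (Pi.evalAddMonoidHom (fun _ => ℕ) ⟨x, hx⟩)))) fun w => ?_
  change (∃ h, P h ∧ h x = w) ↔ ∃ m : Fin N → M, τ w = m ⟨x, hx⟩ ∧ ∃ n ∈ G m, n ⟨x, hx⟩ = w.length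
  constructor
  · rintro ⟨h, hh, rfl⟩
    refine ⟨fun i => τ (h i), rfl, fun i => (h i).length, ⟨(hP h).1 hh, ?_⟩, rfl⟩
    exact Set.mem_iInter.2 fun y => ⟨h y, rfl, rfl⟩
  · rintro ⟨m, hw, n, ⟨hn, hn'⟩, hnw⟩
    have hv : ∀ y, ∃ v, τ v = m y ∧ v.length = n y := Set.mem_iInter.1 hn'
    choose v hv hv' using hv
    -- The prescribed word `w` takes the place of the chosen value at `x`; it has the same type and
    -- length.
    have hg : ∀ i : Fin N, ∃ u, τ u = m i ∧ u.length = n i ∧ (i.1 = x → u = w) := by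
      intro i
      by_cases hi : i = ⟨x, hx⟩
      · subst hi
        exact ⟨w, hw, hnw.symm, fun _ => rfl⟩
      · exact ⟨v i, hv i, hv' i, fun h => (hi (Fin.ext h)).elim⟩
    choose g hg₁ hg₂ hg₃ using hg
    refine ⟨fun i => if hi : i < N then g ⟨i, hi⟩ else [], (hP _).2 ?_, ?_⟩
    · simpa [hg₁, hg₂] using hn
    · simpa [hx] using hg₃ ⟨x, hx⟩ rfl

end HasTypes

/-! ### Bounding the variables and computing expressed languages -/

theorem LenTerm.exists_bound (l : LenTerm α) : ∃ N, ∀ x, l.Occurs x → x < N := by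
  obtain ⟨k₀, s⟩ := l
  simp only [LenTerm.Occurs]
  induction s with
  | nil => exact ⟨0, by simp⟩
  | cons p s ih =>
    obtain ⟨N, hN⟩ := ih
    obtain ⟨k, y | w⟩ := p
    · refine ⟨max N (y + 1), fun x ⟨k', hk⟩ => ?_⟩
      rcases List.mem_cons.1 hk with h | h
      · cases h
        omega
      · have := hN x ⟨k', h⟩
        omega
    · refine ⟨N, fun x ⟨k', hk⟩ => hN x ⟨k', ?_⟩⟩
      simpa using hk

theorem ExtTerm.exists_bound (s : ExtTerm α) : ∃ N, ∀ x, Sum.inl x ∈ s → x < N := by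
  induction s with
  | nil => exact ⟨0, by simp⟩
  | cons c s ih =>
    obtain ⟨N, hN⟩ := ih
    obtain y | a := c
    · refine ⟨max N (y + 1), fun x hx => ?_⟩
      rcases List.mem_cons.1 hx with h | h
      · cases h
        omega
      · have := hN x h
        omega
    · exact ⟨N, fun x hx => hN x (by simpa using hx)⟩

theorem Formula.exists_bound (f : Formula α) : ∃ N, ∀ x, f.Occurs x → x < N := by
  have key : ∀ {p q : ℕ → Prop}, (∃ N, ∀ x, p x → x < N) → (∃ N, ∀ x, q x → x < N) →
      ∃ N, ∀ x, p x ∨ q x → x < N := by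
    rintro p q ⟨N, hN⟩ ⟨N', hN'⟩
    exact ⟨max N N', fun x hx => lt_max_iff.2 (hx.imp (hN x) (hN' x))⟩
  induction f with
  | mem s L => exact s.exists_bound
  | lenEq l₁ l₂ => exact key l₁.exists_bound l₂.exists_bound
  | neg f ih => exact ih
  | and f g ih ih' => exact key ih ih'
  | or f g ih ih' => exact key ih ih'
  | imp f g ih ih' => exact key ih ih'
  | iff f g ih ih' => exact key ih ih'

/-- The languages expressed by formulas with basic terms and length atoms over `C` lie in `C`. -/
theorem expressed_mem_of_basic {C : Set (Language α)} (hC : IsLengthRegular C) {len : Prop}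
    {f : Formula α} (hf : f.Allowed C len False) {x : ℕ} (hx : f.Occurs x) : f.expressed x ∈ C := by
  obtain ⟨N, hN⟩ := f.exists_bound
  refine (HasTypes.sat hC (N := N) ?_ f hf hN).projection_mem hC (hN x hx)
  rintro s L hL (h | ⟨t, rfl⟩) hs
  · exact h.elim
  · exact .mem_basic hC hL t hs

/-- The languages expressed by formulas with extended terms and length atoms over regular languages
are regular. -/
theorem isRegular_expressed {len con : Prop} {f : Formula α}
    (hf : f.Allowed {L | L.IsRegular} len con) {x : ℕ} (hx : f.Occurs x) :
    (f.expressed x).IsRegular := by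
  obtain ⟨N, hN⟩ := f.exists_bound
  exact (HasTypes.sat isLengthRegular_isRegular
    (fun s L hL _ hs => .mem_ext_of_isRegular hL s hs) f hf hN).projection_mem
      isLengthRegular_isRegular (hN x hx)

end StringTheories

namespace StringTheories

/-! ### Comparison of families -/

section Families

variable {A : Type u}

theorem Formula.Allowed.mono {α : Type u} {C : Set (Language α)} {len con len' con' : Prop}
    (hlen : len → len') (hcon : con → con') {f : Formula α} (hf : f.Allowed C len con) :
    f.Allowed C len' con' := by
  induction f with
  | mem s L => exact ⟨hf.1, hf.2.imp_left hcon⟩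
  | lenEq l₁ l₂ => exact hlen hf
  | neg f ih => exact ih hf
  | and f g ih ih' => exact ⟨ih hf.1, ih' hf.2⟩
  | or f g ih ih' => exact ⟨ih hf.1, ih' hf.2⟩
  | imp f g ih ih' => exact ⟨ih hf.1, ih' hf.2⟩
  | iff f g ih ih' => exact ⟨ih hf.1, ih' hf.2⟩

theorem Family.LE.trans {F₁ F₂ F₃ : Family A} (h : F₁.LE F₂) (h' : F₂.LE F₃) : F₁.LE F₃ := by
  intro T₁ h₁
  obtain ⟨T₂, h₂, h₁₂⟩ := h T₁ h₁
  obtain ⟨T₃, h₃, h₂₃⟩ := h' T₂ h₂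
  refine ⟨T₃, h₃, fun f hf x hx => ?_⟩
  obtain ⟨g, hg, y, hy, h⟩ := h₁₂ f hf x hx
  obtain ⟨k, hk, z, hz, h'⟩ := h₂₃ g hg y hy
  exact ⟨k, hk, z, hz, h.trans h'⟩

theorem vplFamily_mono {len con len' con' : Prop} (hlen : len → len') (hcon : con → con') :
    (vplFamily A len con).LE (vplFamily A len' con') := by
  rintro _ ⟨S, κ, rfl⟩
  exact ⟨_, ⟨S, κ, rfl⟩, fun f hf x hx => ⟨f, hf.mono hlen hcon, x, hx, rfl⟩⟩

theorem regFamily_mono {len con len' con' : Prop} (hlen : len → len') (hcon : con → con') :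
    (regFamily A len con).LE (regFamily A len' con') := by
  rintro _ ⟨S, rfl⟩
  exact ⟨_, ⟨S, rfl⟩, fun f hf x hx => ⟨f, hf.mono hlen hcon, x, hx, rfl⟩⟩

theorem expressed_mem {α : Type u} (L : Language α) (x : ℕ) :
    (Formula.mem [Sum.inl x] L).expressed x = L := by
  ext w
  constructor
  · rintro ⟨h, hh, rfl⟩
    simpa [Formula.Sat, ExtTerm.eval] using hh
  · intro hw
    exact ⟨fun _ => w, by simpa [Formula.Sat, ExtTerm.eval] using hw, rfl⟩

theorem vplFamily_len_le (len : Prop) : (vplFamily A len False).LE (VPL A) := by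
  rintro _ ⟨S, κ, rfl⟩
  refine ⟨_, ⟨S, κ, rfl⟩, fun f hf x hx => ⟨.mem [.inl 0] (f.expressed x),
    ⟨expressed_mem_of_basic (isLengthRegular_isVPL κ) hf hx, .inr ⟨.var 0, rfl⟩⟩, 0, ?_, ?_⟩⟩
  · exact List.mem_singleton_self _
  · rw [expressed_mem]

theorem regFamily_le (len con : Prop) : (regFamily A len con).LE (REG A) := by
  rintro _ ⟨S, rfl⟩
  refine ⟨_, ⟨S, rfl⟩, fun f hf x hx => ⟨.mem [.inl 0] (f.expressed x),
    ⟨isRegular_expressed hf hx, .inr ⟨.var 0, rfl⟩⟩, 0, ?_, ?_⟩⟩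
  · exact List.mem_singleton_self _
  · rw [expressed_mem]

end Families

/-! ### Partitions needed for balanced words -/

section Balanced

variable {α : Type u} {κ : α → LetterKind}

/-- If `a` is not a call, the stack is still empty after `aⁿ`, so only the finitely many states can
remember `n`. Two exponents share a state, and their runs can be crossed. -/
theorem IsVPL.call_of_balanced {L : Language α} (hL : IsVPL κ L) {a b : α}
    (h : ∀ n m, List.replicate n a ++ List.replicate m b ∈ L ↔ n = m) : κ a = .call := by
  by_contra ha
  obtain ⟨Q, Γ, _, _, M, rfl⟩ := hL
  have hnil : ∀ n q d, VPA.Run κ M (q, []) (List.replicate n a) d → d.2 = [] := by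
    intro n
    induction n with
    | zero => rintro q d ⟨⟩; rfl
    | succ n ih =>
      rintro q d ⟨e, hs, hr⟩
      cases hs with
      | call h => exact (ha h).elim
      | internal => exact ih _ _ hr
      | popEmpty => exact ih _ _ hr
  have hq : ∀ n, ∃ q, (∃ q₀ ∈ M.start, VPA.Run κ M (q₀, []) (List.replicate n a) (q, [])) ∧
      ∃ r ∈ M.accept, ∃ st, VPA.Run κ M (q, []) (List.replicate n b) (r, st) := by
    intro n
    obtain ⟨q₀, h₀, r, hr, st, hrun⟩ := (h n n).2 rfl
    obtain ⟨⟨q, st'⟩, h₁, h₂⟩ := VPA.run_append.1 hrun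
    obtain rfl := hnil n q₀ _ h₁
    exact ⟨q, ⟨q₀, h₀, h₁⟩, r, hr, st, h₂⟩
  choose q hq₁ hq₂ using hq
  obtain ⟨n, m, hnm, hq⟩ := Finite.exists_ne_map_eq_of_infinite q
  obtain ⟨q₀, h₀, h₁⟩ := hq₁ n
  obtain ⟨r, hr, st, h₂⟩ := hq₂ m
  exact hnm ((h n m).1 ⟨q₀, h₀, r, hr, st, VPA.run_append.2 ⟨_, h₁, hq ▸ h₂⟩⟩)

/-- If `b` is not a return, reading `b`s never inspects the stack, so the continuation depends only
on the state and the same pigeonhole argument applies. -/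
theorem IsVPL.ret_of_balanced {L : Language α} (hL : IsVPL κ L) {a b : α}
    (h : ∀ n m, List.replicate n a ++ List.replicate m b ∈ L ↔ n = m) : κ b = .ret := by
  by_contra hb
  obtain ⟨Q, Γ, _, _, M, rfl⟩ := hL
  have hst : ∀ n q st r st', VPA.Run κ M (q, st) (List.replicate n b) (r, st') →
      ∀ t, ∃ t', VPA.Run κ M (q, t) (List.replicate n b) (r, t') := by
    intro n
    induction n with
    | zero => rintro q st r st' ⟨⟩ t; exact ⟨t, rfl⟩
    | succ n ih =>
      rintro q st r st' ⟨e, hs, hr⟩ t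
      cases hs with
      | call hc h =>
        obtain ⟨t', ht'⟩ := ih _ _ _ _ hr _
        exact ⟨t', _, .call hc h, ht'⟩
      | internal hc h =>
        obtain ⟨t', ht'⟩ := ih _ _ _ _ hr t
        exact ⟨t', _, .internal hc h, ht'⟩
      | pop h => exact (hb h).elim
      | popEmpty h => exact (hb h).elim
  have hq : ∀ n, ∃ q, (∃ q₀ ∈ M.start, ∃ st,
      VPA.Run κ M (q₀, []) (List.replicate n a) (q, st)) ∧
      ∃ r ∈ M.accept, ∀ st, ∃ st', VPA.Run κ M (q, st) (List.replicate n b) (r, st') := by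
    intro n
    obtain ⟨q₀, h₀, r, hr, st, hrun⟩ := (h n n).2 rfl
    obtain ⟨⟨q, st'⟩, h₁, h₂⟩ := VPA.run_append.1 hrun
    exact ⟨q, ⟨q₀, h₀, st', h₁⟩, r, hr, hst n q st' r st h₂⟩
  choose q hq₁ hq₂ using hq
  obtain ⟨n, m, hnm, hq⟩ := Finite.exists_ne_map_eq_of_infinite q
  obtain ⟨q₀, h₀, st, h₁⟩ := hq₁ n
  obtain ⟨r, hr, h₂⟩ := hq₂ m
  obtain ⟨st', h₂⟩ := h₂ st
  exact hnm ((h n m).1 ⟨q₀, h₀, r, hr, st', VPA.run_append.2 ⟨_, h₁, hq ▸ h₂⟩⟩)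

/-- An automaton for the well-matched words over call and return letters. The state records whether
the stack is empty. -/
def dyckVPA (α : Type u) : VPA α Bool Bool where
  start := {true}
  accept := {true}
  callStep q _ := {(false, q)}
  internalStep _ _ := ∅
  retStep _ _ t := {q | t = some q}

/-- The contribution of a letter to the height of the stack. -/
def LetterKind.weight : LetterKind → ℤ
  | .call => 1
  | .internal => 0
  | .ret => -1

/-- The state and the symbols on the stack tell correctly where the stack is empty. -/
def MarksBottom : Bool → List Bool → Prop
  | q, [] => q = true
  | q, γ :: st => q = false ∧ MarksBottom γ st

theorem dyckVPA_run {w : List α} {q q' : Bool} {st st' : List Bool}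
    (h : VPA.Run κ (dyckVPA α) (q, st) w (q', st')) (hq : MarksBottom q st) :
    MarksBottom q' st' ∧ (st'.length : ℤ) = st.length + (w.map fun a => (κ a).weight).sum := by
  induction w generalizing q st with
  | nil =>
    cases h
    simpa using hq
  | cons a w ih =>
    obtain ⟨e, hs, hr⟩ := h
    cases hs with
    | call ha h =>
      cases h
      have := ih hr ⟨rfl, hq⟩
      simp only [List.length_cons, Nat.cast_add, Nat.cast_one, List.map_cons, List.sum_cons, ha,
        LetterKind.weight] at this ⊢
      exact ⟨this.1, by linarith [this.2]⟩
    | internal ha h => exact h.elim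
    | pop ha h =>
      cases h
      have := ih hr hq.2
      simp only [List.length_cons, Nat.cast_add, Nat.cast_one, List.map_cons, List.sum_cons, ha,
        LetterKind.weight] at this ⊢
      exact ⟨this.1, by linarith [this.2]⟩
    | popEmpty ha h => cases h

/-- The accepting state certifies an empty stack, and the stack height is the sum of the weights. -/
theorem sum_weight_of_mem_dyck {w : List α} (hw : w ∈ (dyckVPA α).accepts κ) :
    (w.map fun a => (κ a).weight).sum = 0 := by
  obtain ⟨q, rfl, q', rfl, st, hr⟩ := hw
  obtain ⟨h, h'⟩ := dyckVPA_run hr rfl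
  cases st with
  | nil => simpa using h'.symm
  | cons γ st => exact absurd h.1 (by simp)

theorem dyckVPA_run_replicate {a b : α} (ha : κ a = .call) (hb : κ b = .ret) (n : ℕ) (q : Bool)
    (st : List Bool) :
    VPA.Run κ (dyckVPA α) (q, st) (List.replicate n a ++ List.replicate n b) (q, st) := by
  induction n generalizing q st with
  | zero => rfl
  | succ n ih =>
    rw [List.replicate_succ, List.replicate_succ', List.cons_append, ← List.append_assoc]
    exact ⟨_, .call ha rfl, VPA.run_append.2 ⟨_, ih _ _, VPA.run_singleton.2 (.pop hb rfl)⟩⟩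

theorem replicate_mem_expressed_iff {a b : α} (ha : κ a = .call) (hb : κ b = .ret) (n m : ℕ) :
    List.replicate n a ++ List.replicate m b ∈
      (Formula.mem [.inl 0] ((dyckVPA α).accepts κ)).expressed 0 ↔ n = m := by
  rw [expressed_mem]
  constructor
  · intro h
    have := sum_weight_of_mem_dyck h
    simp [ha, hb, LetterKind.weight] at this
    omega
  · rintro rfl
    exact ⟨true, rfl, true, rfl, [], dyckVPA_run_replicate ha hb n _ _⟩

/-- With concatenation, balanced words that start with return letters can be expressed. -/
def shiftFormula (κ : α → LetterKind) : Formula α :=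
  .and (.mem [.inl 1, .inl 2] ((dyckVPA α).accepts κ))
    (.mem [.inl 1, .inl 0, .inl 2] ((dyckVPA α).accepts κ))

/-- Subtracting the weights of the two balanced words leaves weight zero for variable `0`.
Conversely, `aⁿbⁿ` and `aⁿ(bⁿaⁿ)bⁿ` are both balanced. -/
theorem replicate_mem_expressed_shiftFormula_iff {a b : α} (ha : κ a = .call) (hb : κ b = .ret)
    (n m : ℕ) : List.replicate n b ++ List.replicate m a ∈ (shiftFormula κ).expressed 0 ↔
      n = m := by
  constructor
  · rintro ⟨h, ⟨h₁, h₂⟩, h₀⟩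
    have h₁ := sum_weight_of_mem_dyck h₁
    have h₂ := sum_weight_of_mem_dyck h₂
    simp [ExtTerm.eval, h₀, ha, hb, LetterKind.weight] at h₁ h₂
    omega
  · rintro rfl
    refine ⟨fun i => match i with
      | 0 => List.replicate n b ++ List.replicate n a
      | 1 => List.replicate n a
      | _ => List.replicate n b, ⟨⟨true, rfl, true, rfl, [], ?_⟩, ⟨true, rfl, true, rfl, [], ?_⟩⟩, rfl⟩
    · simpa [ExtTerm.eval] using dyckVPA_run_replicate ha hb n true []
    · have := VPA.run_append.2 ⟨_, dyckVPA_run_replicate ha hb n true [],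
        dyckVPA_run_replicate ha hb n true []⟩
      simpa [ExtTerm.eval] using this

end Balanced

/-! ### Separating concatenation from length atoms -/

section Separation

variable {A : Type u}

theorem map_mem_toPool_iff {S : Finset A} {L : Language S} {v : List S} :
    v.map Subtype.val ∈ StringTheory.toPool L ↔ v ∈ L := by
  constructor
  · rintro ⟨v', hv', h⟩
    rwa [← Subtype.val_injective.list_map h]
  · exact fun h => ⟨v, h, rfl⟩

theorem replicate_mem_iff_of_toPool_eq {S S' : Finset A} {L : Language S} {L' : Language S'}
    (h : StringTheory.toPool L = StringTheory.toPool L') {a b : A} (ha : a ∈ S) (hb : b ∈ S)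
    (ha' : a ∈ S') (hb' : b ∈ S') (n m : ℕ) :
    List.replicate n (⟨a, ha⟩ : S) ++ List.replicate m ⟨b, hb⟩ ∈ L ↔
      List.replicate n (⟨a, ha'⟩ : S') ++ List.replicate m ⟨b, hb'⟩ ∈ L' := by
  rw [← map_mem_toPool_iff, ← map_mem_toPool_iff (L := L'), h]
  simp

theorem not_vpl_con_le_vpl_len [Infinite A] : ¬ (VPL_CON A).LE (VPL_LEN A) := by
  classical
  intro hle
  obtain ⟨a, b, hab⟩ := exists_pair_ne A
  let S : Finset A := {a, b}
  have haS : a ∈ S := by simp [S]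
  have hbS : b ∈ S := by simp [S]
  let κ : S → LetterKind := fun c => if c.1 = a then .call else .ret
  have ha : κ ⟨a, haS⟩ = .call := by simp [κ]
  have hb : κ ⟨b, hbS⟩ = .ret := by simp [κ, hab.symm]
  have hD : IsVPL κ ((dyckVPA S).accepts κ) :=
    ⟨_, _, inferInstance, inferInstance, _, rfl⟩
  obtain ⟨_, ⟨S', κ', rfl⟩, hT⟩ := hle _ ⟨S, κ, rfl⟩
  obtain ⟨f, hf, x, hx, hfx⟩ := hT (.mem [.inl 0] ((dyckVPA S).accepts κ)) ⟨hD, .inl trivial⟩ 0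
    (List.mem_singleton_self _)
  obtain ⟨g, hg, y, hy, hgy⟩ := hT (shiftFormula κ) ⟨⟨hD, .inl trivial⟩, hD, .inl trivial⟩ 0
    (.inr (by simp [Formula.Occurs]))
  -- The target theory may use another alphabet; expressing the word `ab` forces it to contain both
  -- letters.
  have hmem : [a, b] ∈ StringTheory.toPool (f.expressed x) := by
    rw [← hfx]
    exact ⟨_, (replicate_mem_expressed_iff ha hb 1 1).2 rfl, rfl⟩
  obtain ⟨v, -, hv⟩ := hmem
  have hS' : ∀ c ∈ [a, b], c ∈ S' := by
    rw [← hv]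
    simp only [List.mem_map]
    rintro _ ⟨c, -, rfl⟩
    exact c.2
  have haS' : a ∈ S' := hS' a (by simp)
  have hbS' : b ∈ S' := hS' b (by simp)
  have h₁ : κ' ⟨a, haS'⟩ = .call :=
    (expressed_mem_of_basic (isLengthRegular_isVPL κ') hf hx).call_of_balanced (b := ⟨b, hbS'⟩)
      fun n m => by
        rw [← replicate_mem_iff_of_toPool_eq hfx haS hbS, replicate_mem_expressed_iff ha hb]
  have h₂ : κ' ⟨a, haS'⟩ = .ret :=
    (expressed_mem_of_basic (isLengthRegular_isVPL κ') hg hy).ret_of_balanced (a := ⟨b, hbS'⟩)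
      fun n m => by
        rw [← replicate_mem_iff_of_toPool_eq hgy hbS haS,
          replicate_mem_expressed_shiftFormula_iff ha hb]
  rw [h₁] at h₂
  cases h₂

end Separation

end StringTheories

theorem mainTheorem7 (A : Type*) [Infinite A] :
    (StringTheories.Family.Equivalent (StringTheories.VPL A) (StringTheories.VPL_LEN A) ∧
      StringTheories.Family.LT (StringTheories.VPL A) (StringTheories.VPL_CON A) ∧
      StringTheories.Family.LT (StringTheories.VPL_LEN A) (StringTheories.VPL_CON A)) ∧
    (StringTheories.Family.Equivalent (StringTheories.REG A) (StringTheories.REG_LEN A) ∧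
      StringTheories.Family.Equivalent (StringTheories.REG_LEN A) (StringTheories.REG_LEN_CON A) ∧
      StringTheories.Family.Equivalent (StringTheories.REG A) (StringTheories.REG_LEN_CON A)) := by
  open StringTheories in
  have hV : (VPL A).LE (VPL_LEN A) := vplFamily_mono (fun h => h.elim) id
  have hV' : (VPL_LEN A).LE (VPL A) := vplFamily_len_le True
  have hC : (VPL A).LE (VPL_CON A) := vplFamily_mono id fun h => h.elim
  have hR : (REG_LEN A).LE (REG_LEN_CON A) := regFamily_mono id fun h => h.elim
  have hR' : (REG_LEN_CON A).LE (REG A) := regFamily_le True True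
  have hR₁ : (REG A).LE (REG_LEN A) := regFamily_mono (fun h => h.elim) id
  have hsep := not_vpl_con_le_vpl_len (A := A)
  exact ⟨⟨⟨hV, hV'⟩, ⟨hC, fun h => hsep (h.2.trans hV)⟩, hV'.trans hC, fun h => hsep h.2⟩,
    ⟨hR₁, regFamily_le True False⟩, ⟨hR, hR'.trans hR₁⟩, hR₁.trans hR, hR'⟩
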